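/- Let $\sigma_j(\lambda)=\sum_{1\le i_1<\dots<i_j\le n}\lambda_{i_1}\cdots\lambda_{i_j}$ for $\lambda=(\lambda_1,\dots,\lambda_n)\in\mathbb R^n$, write $\sigma_k^{pp}=\partial\sigma_k/\partial\lambda_p$ and $\sigma_k^{pp,qq}=\partial^2\sigma_k/\partial\lambda_p\partial\lambda_q$, and let $\Gamma_k=\{\lambda\in\mathbb R^n:\sigma_j(\lambda)>0\text{ for } j=1,\dots,k\}$ be the Gårding cone. Let $k\ge 1$. There are constants $\delta_0>0$ and $K_0>0$, depending only on $k$, such that for every $n\ge k$, every $A>0$ and all $0<s_0\le s_1$ there is a constant $C>0$, depending only on $n$, $k$, $A$ and the bounds $s_0,s_1$ for $\sigma_k$, with the following property. If $\lambda\in\Gamma_k$ satisfies $\lambda_1\ge\lambda_2\ge\dots\ge\lambda_n>-A$, $s_0\le\sigma_k(\lambda)\le s_1$ and $\lambda_1\ge C$, then for every $K\ge K_0$ and every $\xi=(\xi_1,\dots,\xi_n)\in\mathbb R^n$ $$-\sum_{p,q=1}^n\frac{\sigma_k^{pp,qq}\,\xi_p\xi_q}{\sigma_k}+K\,\frac{\bigl(\sum_{i=1}^n\sigma_k^{ii}\xi_i\bigr)^2}{\sigma_k^2}+2\sum_{i=2}^n\frac{\sigma_k^{ii}\,\xi_i^2}{(\lambda_1+A+1)\,\sigma_k}\;\ge\;(1+\delta_0)\,\frac{\xi_1^2}{\lambda_1^2},$$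 where $\sigma_k$ and its derivatives are evaluated at $\lambda$. -/

import Mathlib

open Finset

noncomputable section

/-- The `k`-th elementary symmetric function `σ_k(lam)` of `lam = (lam_1, …, lam_n) ∈ ℝⁿ`. -/
def sigma {n : ℕ} (k : ℕ) (lam : Fin n → ℝ) : ℝ :=
  MvPolynomial.eval lam (MvPolynomial.esymm (Fin n) ℝ k)

/-- The first partial derivative `σ_k^{pp}(lam) = ∂σ_k/∂lam_p`. -/
def dsigma {n : ℕ} (k : ℕ) (lam : Fin n → ℝ) (p : Fin n) : ℝ :=
  MvPolynomial.eval lam (MvPolynomial.pderiv p (MvPolynomial.esymm (Fin n) ℝ k))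

/-- The second partial derivative `σ_k^{pp,qq}(lam) = ∂²σ_k/∂lam_p∂lam_q`. -/
def ddsigma {n : ℕ} (k : ℕ) (lam : Fin n → ℝ) (p q : Fin n) : ℝ :=
  MvPolynomial.eval lam
    (MvPolynomial.pderiv p (MvPolynomial.pderiv q (MvPolynomial.esymm (Fin n) ℝ k)))

/-- The Gårding cone `Γ_k = {lam ∈ ℝⁿ | σ_j(lam) > 0 for j = 1, …, k}`. -/
def gardingCone (n k : ℕ) : Set (Fin n → ℝ) :=
  {lam | ∀ j : ℕ, 1 ≤ j → j ≤ k → 0 < sigma j lam}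

end

/-! The proof is a blow-up argument. Fix 1 ≤ l < k. Concavity of (σ_k/σ_l)^{1/(k-l)} on Γ_k
(`GardingOn.logHess_add_le`) bounds the first two terms of the left-hand side from below by -D² log
σ_l + (D log σ_l)²/(2(k-l)), derivatives being taken in the direction ξ. The estimate σ_k ≤ C
λ_{l+1} σ_k^{ii} for i > l (`sigma_le_mul_dsigma`) bounds the last sum from below by c ∑_{i>l}
ξ_i²/(λ_1 λ_{l+1}).

If the inequality failed along a sequence with λ_1 → ∞, let (x, y) be a limit point of (λ/λ_1,
ξ/‖ξ‖). Then x ≥ 0, x_1 = 1 and σ_k(x) ≤ 0, so x has exactly l positive entries for some 1 ≤ l < k.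
For this l the rescaled weight 1/λ_{l+1} blows up, which forces y_i = 0 for i > l. On the other
coordinates σ_l is a plain product, and η_i = y_i/x_i satisfies ∑ η_i² + (∑ η_i)²/(2(k-l)) ≤ (1 +
1/(2k+1)) η_1². By Cauchy–Schwarz this allows only η = 0 (`eq_zero_of_sum_sq_le`), contradicting ‖y‖
= 1. -/

/-! ### Recursion and Euler identities, over any commutative ring. -/

section ElementarySymmetric

variable {ι R : Type*} [CommRing R]

/-- The `j`-th elementary symmetric function of the family `x` restricted to the index set `s`. -/
def esymmOn (s : Finset ι) (j : ℕ) (x : ι → R) : R :=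
  ∑ t ∈ s.powersetCard j, ∏ i ∈ t, x i

@[simp]
theorem esymmOn_zero (s : Finset ι) (x : ι → R) : esymmOn s 0 x = 1 := by
  simp [esymmOn]

theorem esymmOn_one (s : Finset ι) (x : ι → R) : esymmOn s 1 x = ∑ i ∈ s, x i := by
  simp [esymmOn, powersetCard_one]

theorem esymmOn_empty_succ (j : ℕ) (x : ι → R) : esymmOn (∅ : Finset ι) (j + 1) x = 0 := by
  rw [esymmOn, powersetCard_eq_empty.2 (by simp), sum_empty]

theorem esymmOn_smul (s : Finset ι) (j : ℕ) (c : R) (x : ι → R) :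
    esymmOn s j (fun i => c * x i) = c ^ j * esymmOn s j x := by
  simp only [esymmOn, mul_sum]
  refine sum_congr rfl fun t ht => ?_
  rw [prod_mul_distrib, prod_const, (mem_powersetCard.1 ht).2]

variable [DecidableEq ι]

theorem esymmOn_insert {s : Finset ι} {a : ι} (ha : a ∉ s) (j : ℕ) (x : ι → R) :
    esymmOn (insert a s) (j + 1) x = esymmOn s (j + 1) x + x a * esymmOn s j x := by
  unfold esymmOn
  rw [powersetCard_succ_insert ha, sum_union, sum_image, mul_sum]
  · congr 1
    refine sum_congr rfl fun t ht => ?_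
    rw [prod_insert fun h => ha ((mem_powersetCard.1 ht).1 h)]
  · intro t ht t' ht' h
    have h1 : a ∉ t := fun h => ha ((mem_powersetCard.1 ht).1 h)
    have h2 : a ∉ t' := fun h => ha ((mem_powersetCard.1 ht').1 h)
    rw [← erase_insert h1, ← erase_insert h2, h]
  · rw [disjoint_left]
    intro t ht ht'
    obtain ⟨u, -, rfl⟩ := mem_image.1 ht'
    exact ha ((mem_powersetCard.1 ht).1 (mem_insert_self _ _))

theorem esymmOn_erase {s : Finset ι} {a : ι} (ha : a ∈ s) (j : ℕ) (x : ι → R) :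
    esymmOn s (j + 1) x = esymmOn (s.erase a) (j + 1) x + x a * esymmOn (s.erase a) j x := by
  conv_lhs => rw [← insert_erase ha]
  exact esymmOn_insert (notMem_erase _ _) j x

/-- Euler's identity for the elementary symmetric functions. -/
theorem sum_mul_esymmOn_erase (s : Finset ι) (j : ℕ) (x : ι → R) :
    ∑ i ∈ s, x i * esymmOn (s.erase i) j x = (j + 1) * esymmOn s (j + 1) x := by
  induction s using Finset.induction_on generalizing j with
  | empty => simp [esymmOn_empty_succ]
  | insert a s ha ih =>
    have h : ∀ i ∈ s, (insert a s).erase i = insert a (s.erase i) := fun i hi =>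
      erase_insert_of_ne fun h => ha (h ▸ hi)
    rw [sum_insert ha, erase_insert ha]
    cases j with
    | zero => simp [esymmOn_one, sum_insert ha]
    | succ j =>
      have h2 : ∑ i ∈ s, x i * esymmOn ((insert a s).erase i) (j + 1) x =
          ∑ i ∈ s, x i * esymmOn (s.erase i) (j + 1) x +
            x a * ∑ i ∈ s, x i * esymmOn (s.erase i) j x := by
        rw [mul_sum, ← sum_add_distrib]
        refine sum_congr rfl fun i hi => ?_
        rw [h i hi, esymmOn_insert fun h => ha (mem_of_mem_erase h)]
        ring
      rw [h2, ih, ih, esymmOn_insert ha]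
      push_cast
      ring

theorem sum_esymmOn_erase (s : Finset ι) (j : ℕ) (x : ι → R) :
    ∑ i ∈ s, esymmOn (s.erase i) j x = (s.card - j) * esymmOn s j x := by
  cases j with
  | zero => simp
  | succ j =>
    have h : ∀ i ∈ s, esymmOn (s.erase i) (j + 1) x =
        esymmOn s (j + 1) x - x i * esymmOn (s.erase i) j x := fun i hi => by
      rw [esymmOn_erase hi]; ring
    rw [sum_congr rfl h, sum_sub_distrib, sum_mul_esymmOn_erase, sum_const, nsmul_eq_mul]
    push_cast
    ring

end ElementarySymmetric

/-! ### Newton's inequality via real-rooted polynomials. -/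

section Newton

open Polynomial

/-- By Rolle, differentiation loses at most one root counted with multiplicity, and it lowers the
degree by one. -/
theorem Polynomial.Splits.derivative_real {f : ℝ[X]} (hf : f.Splits) :
    (derivative f).Splits := by
  have h1 := splits_iff_card_roots.1 hf
  have h2 := card_roots_le_derivative f
  have h3 := card_roots' (derivative f)
  have h4 := natDegree_derivative_le f
  by_cases h : f.natDegree = 0
  · rw [natDegree_eq_zero.1 h |>.choose_spec.symm]
    simp
  · exact splits_iff_card_roots.2 (by omega)

/-- Laguerre's inequality for real-rooted polynomials. -/
theorem Polynomial.Splits.laguerre {f : ℝ[X]} (hf : f.Splits) (x : ℝ) :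
    f.eval x * (derivative (derivative f)).eval x ≤ (derivative f).eval x ^ 2 := by
  -- For g = (X - a)h one has g'² - g g'' = h² + (x - a)²(h'² - h h''), so the inequality passes
  -- from h to g.
  have key : ∀ m : Multiset ℝ, let g := (m.map (fun a => X - C a)).prod
      g.eval x * (derivative (derivative g)).eval x ≤ (derivative g).eval x ^ 2 := by
    intro m
    induction m using Multiset.induction_on with
    | empty => simp
    | cons a m ih =>
      simp only [Multiset.map_cons, Multiset.prod_cons, derivative_mul, derivative_add,
        derivative_sub, derivative_X, derivative_C, eval_add, eval_mul, eval_sub, eval_X, eval_C,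
        sub_zero, one_mul] at ih ⊢
      set g := (m.map (fun a => X - C a)).prod
      nlinarith [mul_le_mul_of_nonneg_left ih (sq_nonneg (x - a)), sq_nonneg (g.eval x)]
  rw [hf.eq_prod_roots]
  have := mul_le_mul_of_nonneg_left (key f.roots) (sq_nonneg f.leadingCoeff)
  simp only [derivative_mul, derivative_C, zero_mul, zero_add, eval_mul, eval_C] at this ⊢
  nlinarith [this]

variable {ι : Type*} [DecidableEq ι]

theorem coeff_prod_one_add_C_mul_X (s : Finset ι) (x : ι → ℝ) (j : ℕ) :
    (∏ i ∈ s, (1 + C (x i) * X)).coeff j = esymmOn s j x := by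
  induction s using Finset.induction_on generalizing j with
  | empty => cases j <;> simp [esymmOn_empty_succ, coeff_one]
  | insert a s ha ih =>
    rw [prod_insert ha, add_mul, one_mul, coeff_add, mul_assoc, coeff_C_mul]
    cases j with
    | zero => simp [ih]
    | succ j => rw [coeff_X_mul, ih, ih, esymmOn_insert ha]

/-- Newton's inequality, without the sharp constant. -/
theorem esymmOn_mul_le_sq (s : Finset ι) (x : ι → ℝ) (j : ℕ) :
    esymmOn s j x * esymmOn s (j + 2) x ≤ esymmOn s (j + 1) x ^ 2 := by
  set p : ℝ[X] := ∏ i ∈ s, (1 + C (x i) * X) with hp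
  have hs : p.Splits := by
    refine Splits.prod fun i _ => Splits.of_natDegree_le_one ?_
    compute_degree
  have hd : ∀ m : ℕ, (derivative^[m] p).Splits := by
    intro m
    induction m with
    | zero => exact hs
    | succ m ih => rw [Function.iterate_succ_apply']; exact ih.derivative_real
  have hc : ∀ m : ℕ, (derivative^[m] p).eval 0 = m.factorial * esymmOn s m x := by
    intro m
    rw [← coeff_zero_eq_eval_zero, coeff_iterate_derivative, zero_add, Nat.descFactorial_self,
      coeff_prod_one_add_C_mul_X, nsmul_eq_mul]
  -- At 0 the derivatives of order j, j+1, j+2 of p are factorial multiples of consecutive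
  -- elementary symmetric functions.
  have h := (hd j).laguerre 0
  rw [← Function.iterate_succ_apply' derivative, ← Function.iterate_succ_apply' derivative,
    hc, hc, hc, Nat.factorial_succ (j + 1), Nat.factorial_succ j] at h
  push_cast at h
  have hf : (0 : ℝ) < j.factorial := by positivity
  have h' : ((j + 1) * (j.factorial : ℝ) ^ 2) *
      ((j + 2) * (esymmOn s j x * esymmOn s (j + 2) x)) ≤
      ((j + 1) * (j.factorial : ℝ) ^ 2) * ((j + 1) * esymmOn s (j + 1) x ^ 2) := by
    convert h using 1 <;> ring
  have h2 := le_of_mul_le_mul_left h' (by positivity)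
  by_contra! hlt
  have h3 : 0 ≤ esymmOn s (j + 1) x ^ 2 := sq_nonneg _
  have : (0 : ℝ) ≤ j := Nat.cast_nonneg j
  nlinarith

end Newton

/-! ### Gårding cones are stable under deleting an entry. -/

section Cone

variable {ι : Type*}

/-- The Gårding cone on the index set `s`. -/
def GardingOn (s : Finset ι) (k : ℕ) (x : ι → ℝ) : Prop :=
  ∀ j ≤ k, 0 < esymmOn s j x

theorem GardingOn.mono {s : Finset ι} {k l : ℕ} {x : ι → ℝ} (h : GardingOn s k x) (hl : l ≤ k) :
    GardingOn s l x :=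
  fun j hj => h j (hj.trans hl)

/-- Write b, a, c for σ_k, σ_{k+1}, σ_{k+2} without the entry x_i. If a ≤ 0 < b, then a + x_i b > 0
and c + x_i a > 0 give bc > (x_i b)(-a) ≥ a², against Newton. -/
theorem GardingOn.erase [DecidableEq ι] {s : Finset ι} {k : ℕ} {x : ι → ℝ} (h : GardingOn s (k + 1) x) {i : ι}
    (hi : i ∈ s) : GardingOn (s.erase i) k x := by
  induction k with
  | zero => intro j hj; simp [Nat.le_zero.1 hj]
  | succ k ih =>
    have ih' := ih (h.mono (by omega))
    intro j hj
    rcases Nat.lt_or_ge k j with hkj | hkj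
    · obtain rfl : j = k + 1 := by omega
      by_contra! hneg
      have h0 := ih' k le_rfl
      have h1 := h (k + 1) (by omega)
      have h2 := h (k + 2) le_rfl
      rw [esymmOn_erase hi] at h1 h2
      have hN := esymmOn_mul_le_sq (s.erase i) x k
      set a := esymmOn (s.erase i) (k + 1) x
      set b := esymmOn (s.erase i) k x
      set c := esymmOn (s.erase i) (k + 2) x
      nlinarith [mul_pos h2 h0, mul_nonneg h1.le (neg_nonneg.2 hneg)]
    · exact ih' j hkj

end Cone

/-! ### Directional derivatives, by evaluating the identities on polynomial lines. -/

section LineDerivatives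

open Polynomial

variable {ι : Type*}

/-- The line `t ↦ x + t ξ`, as a family of polynomials. -/
noncomputable def linePoly (x ξ : ι → ℝ) (i : ι) : ℝ[X] := C (x i) + C (ξ i) * X

/-- The first derivative of `esymmOn s j` at `x` in the direction `ξ`. -/
noncomputable def esymmD (s : Finset ι) (j : ℕ) (x ξ : ι → ℝ) : ℝ :=
  (derivative (esymmOn s j (linePoly x ξ))).eval 0

/-- The second derivative of `esymmOn s j` at `x` in the direction `ξ`. -/
noncomputable def esymmDD (s : Finset ι) (j : ℕ) (x ξ : ι → ℝ) : ℝ :=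
  (derivative (derivative (esymmOn s j (linePoly x ξ)))).eval 0

@[simp]
theorem eval_linePoly (x ξ : ι → ℝ) (i : ι) : (linePoly x ξ i).eval 0 = x i := by
  simp [linePoly]

@[simp]
theorem derivative_linePoly (x ξ : ι → ℝ) (i : ι) : derivative (linePoly x ξ i) = C (ξ i) := by
  simp [linePoly]

theorem eval_esymmOn_linePoly (s : Finset ι) (j : ℕ) (x ξ : ι → ℝ) :
    (esymmOn s j (linePoly x ξ)).eval 0 = esymmOn s j x := by
  simp [esymmOn, eval_finsetSum, eval_prod]

@[simp]
theorem esymmD_zero (s : Finset ι) (x ξ : ι → ℝ) : esymmD s 0 x ξ = 0 := by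
  simp [esymmD]

@[simp]
theorem esymmDD_zero (s : Finset ι) (x ξ : ι → ℝ) : esymmDD s 0 x ξ = 0 := by
  simp [esymmDD]

theorem esymmDD_one (s : Finset ι) (x ξ : ι → ℝ) : esymmDD s 1 x ξ = 0 := by
  simp [esymmDD, esymmOn_one]

theorem esymmD_smul (s : Finset ι) (j : ℕ) (c : ℝ) (x ξ : ι → ℝ) :
    esymmD s j (fun i => c * x i) (fun i => c * ξ i) = c ^ j * esymmD s j x ξ := by
  have h : linePoly (fun i => c * x i) (fun i => c * ξ i) = fun i => C c * linePoly x ξ i := by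
    ext1 i; simp [linePoly]; ring
  rw [esymmD, esymmD, h, esymmOn_smul, ← C_pow, derivative_C_mul, eval_mul, eval_C]

theorem esymmDD_smul (s : Finset ι) (j : ℕ) (c : ℝ) (x ξ : ι → ℝ) :
    esymmDD s j (fun i => c * x i) (fun i => c * ξ i) = c ^ j * esymmDD s j x ξ := by
  have h : linePoly (fun i => c * x i) (fun i => c * ξ i) = fun i => C c * linePoly x ξ i := by
    ext1 i; simp [linePoly]; ring
  rw [esymmDD, esymmDD, h, esymmOn_smul, ← C_pow, derivative_C_mul, derivative_C_mul, eval_mul,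
    eval_C]

variable [DecidableEq ι]

theorem esymmD_erase {s : Finset ι} {a : ι} (ha : a ∈ s) (j : ℕ) (x ξ : ι → ℝ) :
    esymmD s (j + 1) x ξ = esymmD (s.erase a) (j + 1) x ξ +
      (ξ a * esymmOn (s.erase a) j x + x a * esymmD (s.erase a) j x ξ) := by
  simp only [esymmD, esymmOn_erase ha, derivative_add, derivative_mul, derivative_linePoly,
    eval_add, eval_mul, eval_C, eval_linePoly, eval_esymmOn_linePoly]

theorem esymmDD_erase {s : Finset ι} {a : ι} (ha : a ∈ s) (j : ℕ) (x ξ : ι → ℝ) :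
    esymmDD s (j + 1) x ξ = esymmDD (s.erase a) (j + 1) x ξ +
      (2 * (ξ a * esymmD (s.erase a) j x ξ) + x a * esymmDD (s.erase a) j x ξ) := by
  simp only [esymmDD, esymmD, esymmOn_erase ha, derivative_add, derivative_mul,
    derivative_linePoly, derivative_C, zero_mul, zero_add,
    eval_add, eval_mul, eval_C, eval_linePoly]
  ring

/-- Euler's identity holds in ℝ[X]; it is applied to the family `linePoly x ξ` and differentiated at
0. -/
theorem sum_esymmD_erase (s : Finset ι) (j : ℕ) (x ξ : ι → ℝ) :
    ∑ i ∈ s, (ξ i * esymmOn (s.erase i) j x + x i * esymmD (s.erase i) j x ξ) =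
      (j + 1) * esymmD s (j + 1) x ξ := by
  have h := congrArg (fun p : ℝ[X] => (derivative p).eval 0)
    (sum_mul_esymmOn_erase s j (linePoly x ξ))
  have hc : ((j : ℝ[X]) + 1) = C ((j : ℝ) + 1) := by simp
  rw [hc] at h
  simpa only [derivative_sum, derivative_mul, derivative_linePoly, derivative_C, zero_mul,
    zero_add, eval_finsetSum, eval_add, eval_mul, eval_C, eval_linePoly,
    eval_esymmOn_linePoly, esymmD] using h

theorem sum_esymmDD_erase (s : Finset ι) (j : ℕ) (x ξ : ι → ℝ) :
    ∑ i ∈ s, (2 * (ξ i * esymmD (s.erase i) j x ξ) + x i * esymmDD (s.erase i) j x ξ) =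
      (j + 1) * esymmDD s (j + 1) x ξ := by
  have h := congrArg (fun p : ℝ[X] => (derivative (derivative p)).eval 0)
    (sum_mul_esymmOn_erase s j (linePoly x ξ))
  have hc : ((j : ℝ[X]) + 1) = C ((j : ℝ) + 1) := by simp
  rw [hc] at h
  simp only [derivative_sum, derivative_mul, derivative_linePoly, derivative_C, zero_mul,
    zero_add, eval_finsetSum, eval_add, eval_mul, eval_C, eval_linePoly, derivative_add] at h
  simp only [esymmDD, esymmD]
  rw [← h]
  refine sum_congr rfl fun i _ => ?_
  ring

end LineDerivatives

/-! ### Concavity of quotients of elementary symmetric functions. -/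

section Concavity

variable {ι : Type*} [DecidableEq ι]

/-- The second derivative of `x a / (x b + a)` is nonpositive if that of `a / b` is and
`x` is linear; here `aᵢ`, `bᵢ` are the `i`-th derivatives of `a`, `b`. -/
theorem concave_harmonic_aux {x x₁ a a₁ a₂ b b₁ b₂ : ℝ} (hb : 0 < b) (hg : 0 < a + x * b)
    (h : a₂ * b ^ 2 - 2 * a₁ * b₁ * b - a * b * b₂ + 2 * a * b₁ ^ 2 ≤ 0) :
    (2 * (x₁ * a₁) + x * a₂) * (a + x * b) ^ 2 -
      2 * (x₁ * a + x * a₁) * (a₁ + (x₁ * b + x * b₁)) * (a + x * b) -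
      (x * a) * (a + x * b) * (a₂ + (2 * (x₁ * b₁) + x * b₂)) +
      2 * (x * a) * (a₁ + (x₁ * b + x * b₁)) ^ 2 ≤ 0 := by
  have key : b * ((2 * (x₁ * a₁) + x * a₂) * (a + x * b) ^ 2 -
      2 * (x₁ * a + x * a₁) * (a₁ + (x₁ * b + x * b₁)) * (a + x * b) -
      (x * a) * (a + x * b) * (a₂ + (2 * (x₁ * b₁) + x * b₂)) +
      2 * (x * a) * (a₁ + (x₁ * b + x * b₁)) ^ 2) =
      x ^ 2 * (a + x * b) * (a₂ * b ^ 2 - 2 * a₁ * b₁ * b - a * b * b₂ + 2 * a * b₁ ^ 2) -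
        2 * (x₁ * a * b - x * (a₁ * b - a * b₁)) ^ 2 := by
    ring
  have h1 := mul_nonpos_of_nonneg_of_nonpos (mul_nonneg (sq_nonneg x) hg.le) h
  have h2 := sq_nonneg (x₁ * a * b - x * (a₁ * b - a * b₁))
  by_contra! h3
  have := mul_pos hb h3
  linarith

/-- Concavity of `σ_{j+1} / σ_j` on the Gårding cone (Marcus–Lopes), in infinitesimal form. -/
theorem GardingOn.quotient_concave {s : Finset ι} {j : ℕ} {x : ι → ℝ}
    (hx : GardingOn s (j + 1) x) (ξ : ι → ℝ) :
    esymmDD s (j + 1) x ξ * esymmOn s j x ^ 2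
      - 2 * esymmD s (j + 1) x ξ * esymmD s j x ξ * esymmOn s j x
      - esymmOn s (j + 1) x * esymmOn s j x * esymmDD s j x ξ
      + 2 * esymmOn s (j + 1) x * esymmD s j x ξ ^ 2 ≤ 0 := by
  induction j generalizing s with
  | zero => simp [esymmDD_one]
  | succ j ih =>
    -- By Euler, (j+2) σ_{j+2}/σ_{j+1} is the sum of x_i a/(a + x_i b), with a, b the functions
    -- σ_{j+1}, σ_j without x_i. Each term is built harmonically from x_i and a/b, and a/b is
    -- concave by induction. Every inequality here is (f/g)'' ≤ 0 multiplied by g³.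
    have hterm : ∀ i ∈ s,
        (2 * (ξ i * esymmD (s.erase i) (j + 1) x ξ) + x i * esymmDD (s.erase i) (j + 1) x ξ) *
            esymmOn s (j + 1) x ^ 2
          - 2 * (ξ i * esymmOn (s.erase i) (j + 1) x + x i * esymmD (s.erase i) (j + 1) x ξ) *
            esymmD s (j + 1) x ξ * esymmOn s (j + 1) x
          - (x i * esymmOn (s.erase i) (j + 1) x) * esymmOn s (j + 1) x * esymmDD s (j + 1) x ξ
          + 2 * (x i * esymmOn (s.erase i) (j + 1) x) * esymmD s (j + 1) x ξ ^ 2 ≤ 0 := by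
      intro i hi
      have hg := hx (j + 1) (by omega)
      have hi' := hx.erase hi
      rw [esymmOn_erase hi] at hg
      rw [esymmOn_erase hi j, esymmD_erase hi j, esymmDD_erase hi j]
      exact concave_harmonic_aux (hi' j (by omega)) hg (ih hi')
    have hsum := sum_nonpos hterm
    simp only [sum_add_distrib, sum_sub_distrib, ← sum_mul, ← mul_sum] at hsum
    have e0 := sum_mul_esymmOn_erase s (j + 1) x
    have e1 := sum_esymmD_erase s (j + 1) x ξ
    have e2 := sum_esymmDD_erase s (j + 1) x ξ
    simp only [sum_add_distrib, ← mul_sum] at e1 e2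
    rw [e0, e1, e2] at hsum
    have hj : (0 : ℝ) < ((j + 1 : ℕ) : ℝ) + 1 := by positivity
    refine le_of_mul_le_mul_left ?_ hj
    rw [mul_zero]
    refine le_trans (le_of_eq ?_) hsum
    ring

/-- The second derivative of `log σ_j` in the direction `ξ`. -/
noncomputable def logHess (s : Finset ι) (j : ℕ) (x ξ : ι → ℝ) : ℝ :=
  esymmDD s j x ξ / esymmOn s j x - (esymmD s j x ξ / esymmOn s j x) ^ 2

/-- The first derivative of `log σ_j` in the direction `ξ`. -/
noncomputable def logGrad (s : Finset ι) (j : ℕ) (x ξ : ι → ℝ) : ℝ :=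
  esymmD s j x ξ / esymmOn s j x

/-- For q = σ_{j+1}/σ_j the left-hand side is (log q)'' + ((log q)')² = q''/q. -/
theorem GardingOn.logHess_succ_le {s : Finset ι} {j : ℕ} {x : ι → ℝ}
    (hx : GardingOn s (j + 1) x) (ξ : ι → ℝ) :
    logHess s (j + 1) x ξ - logHess s j x ξ + (logGrad s (j + 1) x ξ - logGrad s j x ξ) ^ 2
      ≤ 0 := by
  have h := hx.quotient_concave ξ
  have hf := hx (j + 1) le_rfl
  have hg := hx j (by omega)
  unfold logHess logGrad
  set f := esymmOn s (j + 1) x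
  set g := esymmOn s j x
  set f1 := esymmD s (j + 1) x ξ
  set g1 := esymmD s j x ξ
  set f2 := esymmDD s (j + 1) x ξ
  set g2 := esymmDD s j x ξ
  have : f2 / f - (f1 / f) ^ 2 - (g2 / g - (g1 / g) ^ 2) + (f1 / f - g1 / g) ^ 2 =
      (f2 * g ^ 2 - 2 * f1 * g1 * g - f * g * g2 + 2 * f * g1 ^ 2) / (f * g ^ 2) := by
    field_simp
    ring
  rw [this]
  exact div_nonpos_of_nonpos_of_nonneg h (by positivity)

/-- Concavity of `(σ_{l+m} / σ_l)^{1/m}` on the Gårding cone, in infinitesimal form. -/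
theorem GardingOn.logHess_add_le {s : Finset ι} {l m : ℕ} {x : ι → ℝ}
    (hx : GardingOn s (l + m) x) (ξ : ι → ℝ) :
    m * (logHess s (l + m) x ξ - logHess s l x ξ) +
      (logGrad s (l + m) x ξ - logGrad s l x ξ) ^ 2 ≤ 0 := by
  induction m with
  | zero => simp
  | succ m ih =>
    have h1 := ih (hx.mono (by omega))
    have h2 := GardingOn.logHess_succ_le (j := l + m) hx ξ
    rw [← add_assoc]
    rcases Nat.eq_zero_or_pos m with rfl | hm
    · simpa using h2
    push_cast
    generalize logHess s (l + m + 1) x ξ = A at *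
    generalize logHess s (l + m) x ξ = B at *
    generalize logHess s l x ξ = D at *
    generalize logGrad s (l + m + 1) x ξ = a at *
    generalize logGrad s (l + m) x ξ = b at *
    generalize logGrad s l x ξ = d at *
    have hm' : (0 : ℝ) < m := by exact_mod_cast hm
    refine le_of_mul_le_mul_left ?_ hm'
    -- Cauchy–Schwarz in the form (u + v)²/(m + 1) ≤ u² + v²/m, with u = a - b and v = b - d.
    nlinarith [mul_le_mul_of_nonneg_left h2 (by positivity : (0 : ℝ) ≤ m * (m + 1)),
      mul_le_mul_of_nonneg_left h1 (by positivity : (0 : ℝ) ≤ m + 1),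
      sq_nonneg (m * (a - b) - (b - d))]

end Concavity

/-! ### Lower bounds for the first derivatives of σ_k. -/

section LowerBounds

variable {ι : Type*} [DecidableEq ι]

/-- `∂σ_{k+1}/∂x_i` decreases as `x_i` increases. -/
theorem GardingOn.esymmOn_erase_le {s : Finset ι} {k : ℕ} {x : ι → ℝ}
    (hx : GardingOn s (k + 1) x) {p i : ι} (hp : p ∈ s) (hi : i ∈ s) (hip : x i ≤ x p) :
    esymmOn (s.erase p) k x ≤ esymmOn (s.erase i) k x := by
  rcases eq_or_ne p i with rfl | hne
  · rfl
  cases k with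
  | zero => simp
  | succ k =>
    have hpi : p ∈ s.erase i := mem_erase.2 ⟨hne, hp⟩
    have hip' : i ∈ s.erase p := mem_erase.2 ⟨hne.symm, hi⟩
    rw [esymmOn_erase hpi, esymmOn_erase hip', erase_right_comm]
    have := ((hx.erase hi).erase hpi) k le_rfl
    nlinarith

/-- If `x p` is the largest entry then `σ_{k+1} ≤ |s| x_p ∂σ_{k+1}/∂x_p`. -/
theorem GardingOn.esymmOn_le_of_max {s : Finset ι} {k : ℕ} {x : ι → ℝ}
    (hx : GardingOn s (k + 1) x) {p : ι} (hp : p ∈ s) (hmax : ∀ i ∈ s, x i ≤ x p) :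
    esymmOn s (k + 1) x ≤ s.card * (x p * esymmOn (s.erase p) k x) := by
  have hE := sum_mul_esymmOn_erase s k x
  have h1 : (1 : ℝ) ≤ s.card := by exact_mod_cast card_pos.2 ⟨p, hp⟩
  have hpos := hx (k + 1) le_rfl
  have hk : (0 : ℝ) ≤ k := Nat.cast_nonneg k
  rcases le_or_gt (esymmOn (s.erase p) (k + 1) x) 0 with hneg | hp'
  · rw [esymmOn_erase hp] at hpos ⊢
    nlinarith
  · have hG : GardingOn (s.erase p) (k + 1) x := by
      intro j hj
      rcases Nat.lt_or_ge j (k + 1) with h | h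
      · exact hx.erase hp j (by omega)
      · obtain rfl : j = k + 1 := by omega
        exact hp'
    have h2 : ∑ i ∈ s.erase p, x i * esymmOn ((s.erase p).erase i) k x ≤
        ∑ i ∈ s.erase p, x p * esymmOn ((s.erase p).erase i) k x :=
      sum_le_sum fun i hi => mul_le_mul_of_nonneg_right (hmax i (mem_of_mem_erase hi))
        (hG.erase hi k le_rfl).le
    rw [← mul_sum, sum_mul_esymmOn_erase, sum_esymmOn_erase, card_erase_of_mem hp,
      Nat.cast_sub (card_pos.2 ⟨p, hp⟩)] at h2
    have h3 := esymmOn_erase hp k x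
    push_cast at h2
    nlinarith

/-- If fewer than `k + 1` entries exceed `x m`, then `σ_{k+1}` is controlled by
`x_m ∂σ_{k+1}/∂x_m`. -/
theorem GardingOn.esymmOn_le_of_card_lt {s T : Finset ι} {k : ℕ} {x : ι → ℝ} {m : ι}
    (hx : GardingOn s (k + 1) x) (hm : m ∈ s) (hTs : T ⊆ s) (hmT : m ∉ T) (hT : T.card ≤ k)
    (hge : ∀ i ∈ T, x m ≤ x i) (hle : ∀ i ∈ s, i ∉ T → x i ≤ x m) {N : ℝ} (hN : s.card ≤ N) :
    esymmOn s (k + 1) x ≤ (2 * N) ^ (T.card + 1) * (x m * esymmOn (s.erase m) k x) := by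
  induction hc : T.card generalizing s T k with
  | zero =>
    obtain rfl := card_eq_zero.1 hc
    have h := hx.esymmOn_le_of_max hm fun i hi => hle i hi (notMem_empty i)
    have hpos := hx (k + 1) le_rfl
    have h0 : (0 : ℝ) ≤ s.card := Nat.cast_nonneg _
    have hX : 0 ≤ x m * esymmOn (s.erase m) k x := by
      by_contra! hneg
      nlinarith
    rw [zero_add, pow_one]
    nlinarith
  | succ c ih =>
    -- Delete the largest entry and apply the induction hypothesis to the rest.
    obtain ⟨p, hpT, hpmax⟩ := exists_max_image T x (card_pos.1 (by omega))
    obtain ⟨k, rfl⟩ : ∃ k', k = k' + 1 := ⟨k - 1, by omega⟩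
    have hps := hTs hpT
    have hmp : m ≠ p := fun h => hmT (h ▸ hpT)
    have hms : m ∈ s.erase p := mem_erase.2 ⟨hmp, hm⟩
    have hpsm : p ∈ s.erase m := mem_erase.2 ⟨hmp.symm, hps⟩
    have hmax : ∀ i ∈ s, x i ≤ x p := fun i hi => by
      by_cases hiT : i ∈ T
      · exact hpmax i hiT
      · exact (hle i hi hiT).trans (hge p hpT)
    have hN1 : 1 ≤ N := le_trans (by exact_mod_cast card_pos.2 ⟨p, hps⟩) hN
    have h1 := hx.esymmOn_le_of_max hps hmax
    have hpos := hx (k + 1 + 1) le_rfl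
    have hb := hx.erase hps (k + 1) le_rfl
    have hd := (hx.erase hps).erase hms k le_rfl
    have hcm := hx.erase hm (k + 1) le_rfl
    have h2 := ih (hx.erase hps) hms (T := T.erase p) (erase_subset_erase _ hTs)
      (fun h => hmT (mem_of_mem_erase h)) (by rw [card_erase_of_mem hpT]; omega)
      (fun i hi => hge i (mem_of_mem_erase hi))
      (fun i hi hiT => hle i (mem_of_mem_erase hi)
        fun h => hiT (mem_erase.2 ⟨ne_of_mem_erase hi, h⟩))
      (le_trans (by exact_mod_cast card_le_card (erase_subset _ _)) hN)
      (by rw [card_erase_of_mem hpT]; omega)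
    have h3 := esymmOn_erase hms k x
    have h4 := esymmOn_erase hpsm k x
    have h5 := hx.esymmOn_erase_le hps hm (hmax m hm)
    rw [erase_right_comm] at h4
    have hQ1 : 1 ≤ (2 * N) ^ (c + 1) := one_le_pow₀ (by linarith)
    rw [pow_succ]
    set Q := (2 * N) ^ (c + 1)
    set S := esymmOn s (k + 1 + 1) x
    set b := esymmOn (s.erase p) (k + 1) x
    set d := esymmOn ((s.erase p).erase m) k x
    set e := esymmOn ((s.erase p).erase m) (k + 1) x
    set g := esymmOn (s.erase m) (k + 1) x
    have hxm : 0 < x m := by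
      by_contra! hneg
      nlinarith [mul_nonneg (by linarith : 0 ≤ Q) (mul_nonneg (neg_nonneg.2 hneg) hd.le)]
    have hxp : 0 < x p := hxm.trans_le (hge p hpT)
    have hS : S ≤ N * (x p * b) := h1.trans (mul_le_mul_of_nonneg_right hN (by positivity))
    -- If x_p ≥ 2x_m, then e + x_m d = b > 0 gives g = e + x_p d ≥ x_p d/2, and the induction
    -- hypothesis b ≤ Q x_m d applies. Otherwise x_p ≤ 2x_m, and b ≤ g suffices.
    rcases le_total (2 * x m) (x p) with hsmall | hbig
    · have h6 : x p * d ≤ 2 * g := by nlinarith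
      calc S ≤ N * (x p * b) := hS
        _ ≤ N * (x p * (Q * (x m * d))) := by gcongr
        _ = N * Q * x m * (x p * d) := by ring
        _ ≤ N * Q * x m * (2 * g) := by gcongr
        _ = Q * (2 * N) * (x m * g) := by ring
    · calc S ≤ N * (x p * b) := hS
        _ ≤ N * ((2 * x m) * g) := by gcongr
        _ = 1 * (2 * N) * (x m * g) := by ring
        _ ≤ Q * (2 * N) * (x m * g) := by gcongr

end LowerBounds

/-! ### Chain rule between partial derivatives and derivatives along lines. -/

section Bridge

open MvPolynomial

variable {n : ℕ}

theorem sigma_eq_esymmOn (k : ℕ) (x : Fin n → ℝ) : sigma k x = esymmOn univ k x := by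
  simp [sigma, esymmOn, esymm, map_sum, map_prod]

theorem esymm_eq_esymmOn (k : ℕ) : esymm (Fin n) ℝ k = esymmOn univ k X := rfl

theorem pderiv_esymmOn_erase (s : Finset (Fin n)) (p : Fin n) (j : ℕ) :
    pderiv p (esymmOn (s.erase p) j (X : Fin n → MvPolynomial (Fin n) ℝ)) = 0 := by
  rw [esymmOn, map_sum]
  refine sum_eq_zero fun t ht => ?_
  have hp : p ∉ t := fun h => notMem_erase p s ((mem_powersetCard.1 ht).1 h)
  clear ht
  induction t using Finset.induction_on with
  | empty => simp
  | insert i t hi ih =>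
    rw [mem_insert, not_or] at hp
    rw [prod_insert hi, pderiv_mul, ih hp.2, pderiv_X_of_ne (Ne.symm hp.1), zero_mul, mul_zero,
      add_zero]

theorem dsigma_eq_esymmOn (k : ℕ) (x : Fin n → ℝ) (p : Fin n) :
    dsigma (k + 1) x p = esymmOn (univ.erase p) k x := by
  rw [dsigma, esymm_eq_esymmOn, esymmOn_erase (mem_univ p), map_add, Derivation.leibniz,
    pderiv_esymmOn_erase, pderiv_esymmOn_erase, pderiv_X_self]
  simp [esymmOn, map_sum, map_prod]

theorem derivative_aeval_mvPolynomial (u : Fin n → Polynomial ℝ) (P : MvPolynomial (Fin n) ℝ) :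
    Polynomial.derivative (aeval u P) =
      ∑ i, aeval u (pderiv i P) * Polynomial.derivative (u i) := by
  induction P using MvPolynomial.induction_on with
  | C a => simp [Polynomial.algebraMap_eq]
  | add p q hp hq => simp only [map_add, hp, hq, add_mul, sum_add_distrib]
  | mul_X p i hp =>
    have h : ∀ j, aeval u (pderiv j (p * X i)) * Polynomial.derivative (u j) =
        u i * (aeval u (pderiv j p) * Polynomial.derivative (u j)) +
          aeval u p * (if j = i then Polynomial.derivative (u i) else 0) := by
      intro j
      rw [pderiv_mul, map_add, map_mul, map_mul, aeval_X]
      rcases eq_or_ne j i with rfl | hne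
      · simp; ring
      · rw [pderiv_X_of_ne hne.symm]
        simp [hne]; ring
    rw [sum_congr rfl fun j _ => h j, sum_add_distrib, ← mul_sum, ← mul_sum, ← hp]
    simp; ring

theorem eval_aeval_linePoly (x ξ : Fin n → ℝ) (P : MvPolynomial (Fin n) ℝ) :
    (aeval (linePoly x ξ) P).eval 0 = eval x P := by
  induction P using MvPolynomial.induction_on with
  | C a => simp [Polynomial.algebraMap_eq]
  | add p q hp hq => simp [hp, hq]
  | mul_X p i hp => simp [hp]

theorem aeval_esymm_linePoly (k : ℕ) (x ξ : Fin n → ℝ) :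
    aeval (linePoly x ξ) (esymm (Fin n) ℝ k) = esymmOn univ k (linePoly x ξ) := by
  simp [esymm, esymmOn, map_sum, map_prod]

theorem esymmD_eq_sum (k : ℕ) (x ξ : Fin n → ℝ) :
    esymmD univ k x ξ = ∑ i, dsigma k x i * ξ i := by
  rw [esymmD, ← aeval_esymm_linePoly, derivative_aeval_mvPolynomial, Polynomial.eval_finsetSum]
  simp only [derivative_linePoly, Polynomial.eval_mul, Polynomial.eval_C, eval_aeval_linePoly,
    dsigma]

theorem esymmDD_eq_sum (k : ℕ) (x ξ : Fin n → ℝ) :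
    esymmDD univ k x ξ = ∑ p, ∑ q, ddsigma k x p q * ξ p * ξ q := by
  rw [esymmDD, ← aeval_esymm_linePoly, derivative_aeval_mvPolynomial, sum_comm]
  simp only [Polynomial.derivative_sum, Polynomial.derivative_mul, derivative_aeval_mvPolynomial,
    derivative_linePoly, Polynomial.derivative_C, mul_zero, add_zero, Polynomial.eval_finsetSum,
    Polynomial.eval_mul, Polynomial.eval_C, eval_aeval_linePoly, sum_mul, ddsigma]

end Bridge

/-! ### The limiting quadratic form on the nonzero coordinates. -/

section Limit

variable {ι : Type*} [DecidableEq ι]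

/-- Any other subset of the same size contains an index outside L. The general ring lets this apply
to `linePoly` as well as to real vectors. -/
theorem esymmOn_card_of_eq_zero {R : Type*} [CommRing R] {s L : Finset ι} (hL : L ⊆ s)
    {u : ι → R} (hu : ∀ i ∈ s, i ∉ L → u i = 0) :
    esymmOn s L.card u = ∏ i ∈ L, u i := by
  refine sum_eq_single_of_mem L (mem_powersetCard.2 ⟨hL, rfl⟩) fun t ht hne => ?_
  obtain ⟨hts, hcard⟩ := mem_powersetCard.1 ht
  obtain ⟨i, hit, hiL⟩ : ∃ i ∈ t, i ∉ L := by
    by_contra! h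
    exact hne (eq_of_subset_of_card_le h hcard.ge)
  exact prod_eq_zero hit (hu i (hts hit) hiL)

theorem derivative_prod_linePoly (L : Finset ι) {x : ι → ℝ} (y : ι → ℝ)
    (hx : ∀ i ∈ L, x i ≠ 0) :
    (Polynomial.derivative (∏ i ∈ L, linePoly x y i)).eval 0 =
      (∏ i ∈ L, x i) * ∑ i ∈ L, y i / x i := by
  induction L using Finset.induction_on with
  | empty => simp
  | insert a L ha ih =>
    have hxa := hx a (mem_insert_self a L)
    rw [prod_insert ha, prod_insert ha, sum_insert ha, Polynomial.derivative_mul,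
      Polynomial.eval_add, Polynomial.eval_mul, Polynomial.eval_mul,
      ih fun i hi => hx i (mem_insert_of_mem hi)]
    simp only [derivative_linePoly, Polynomial.eval_C, eval_linePoly, Polynomial.eval_prod]
    field_simp

theorem derivative_derivative_prod_linePoly (L : Finset ι) {x : ι → ℝ} (y : ι → ℝ)
    (hx : ∀ i ∈ L, x i ≠ 0) :
    (Polynomial.derivative (Polynomial.derivative (∏ i ∈ L, linePoly x y i))).eval 0 =
      (∏ i ∈ L, x i) * ((∑ i ∈ L, y i / x i) ^ 2 - ∑ i ∈ L, (y i / x i) ^ 2) := by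
  induction L using Finset.induction_on with
  | empty => simp
  | insert a L ha ih =>
    have hxa := hx a (mem_insert_self a L)
    have hx' : ∀ i ∈ L, x i ≠ 0 := fun i hi => hx i (mem_insert_of_mem hi)
    rw [prod_insert ha, prod_insert ha, sum_insert ha, sum_insert ha]
    simp only [Polynomial.derivative_mul, Polynomial.derivative_add, derivative_linePoly,
      Polynomial.derivative_C, zero_mul, zero_add, Polynomial.eval_add, Polynomial.eval_mul,
      Polynomial.eval_C, eval_linePoly, ih hx', derivative_prod_linePoly L y hx']
    field_simp
    ring

/-- Along the line σ_{|L|} is the product over L, so its logarithm is a sum of one-variable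
logarithms. -/
theorem logGrad_of_eq_zero {s L : Finset ι} (hL : L ⊆ s) {x y : ι → ℝ} (hx : ∀ i ∈ L, x i ≠ 0)
    (hx0 : ∀ i ∈ s, i ∉ L → x i = 0) (hy0 : ∀ i ∈ s, i ∉ L → y i = 0) :
    logGrad s L.card x y = ∑ i ∈ L, y i / x i := by
  have hu : ∀ i ∈ s, i ∉ L → linePoly x y i = 0 := fun i hi hiL => by
    simp [linePoly, hx0 i hi hiL, hy0 i hi hiL]
  rw [logGrad, esymmD, esymmOn_card_of_eq_zero hL hu, esymmOn_card_of_eq_zero hL hx0,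
    derivative_prod_linePoly L y hx, mul_div_cancel_left₀ _ (prod_ne_zero_iff.2 hx)]

theorem logHess_of_eq_zero {s L : Finset ι} (hL : L ⊆ s) {x y : ι → ℝ} (hx : ∀ i ∈ L, x i ≠ 0)
    (hx0 : ∀ i ∈ s, i ∉ L → x i = 0) (hy0 : ∀ i ∈ s, i ∉ L → y i = 0) :
    logHess s L.card x y = -∑ i ∈ L, (y i / x i) ^ 2 := by
  have hu : ∀ i ∈ s, i ∉ L → linePoly x y i = 0 := fun i hi hiL => by
    simp [linePoly, hx0 i hi hiL, hy0 i hi hiL]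
  have hg := logGrad_of_eq_zero hL hx hx0 hy0
  rw [logGrad] at hg
  rw [logHess, hg, esymmDD, esymmOn_card_of_eq_zero hL hu, esymmOn_card_of_eq_zero hL hx0,
    derivative_derivative_prod_linePoly L y hx, mul_div_cancel_left₀ _ (prod_ne_zero_iff.2 hx)]
  ring

/-- The strict gain in the limiting quadratic form. -/
theorem eq_zero_of_sum_sq_le {L : Finset ι} {o : ι} (ho : o ∈ L) {k : ℕ} (hk : L.card < k)
    {η : ι → ℝ}
    (h : ∑ i ∈ L, η i ^ 2 + (∑ i ∈ L, η i) ^ 2 / (2 * ((k : ℝ) - L.card)) ≤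
      (1 + 1 / (2 * (k : ℝ) + 1)) * η o ^ 2) :
    ∀ i ∈ L, η i = 0 := by
  have hcs := sq_sum_le_card_mul_sum_sq (s := L.erase o) (f := η)
  rw [card_erase_of_mem ho, Nat.cast_sub (card_pos.2 ⟨o, ho⟩)] at hcs
  rw [← add_sum_erase L _ ho, ← add_sum_erase L _ ho] at h
  have hm1 : (1 : ℝ) ≤ (k : ℝ) - L.card := by
    have : (L.card : ℝ) + 1 ≤ k := by exact_mod_cast hk
    linarith
  have hr0 : (0 : ℝ) ≤ (L.card : ℝ) - (1 : ℕ) := by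
    have : (1 : ℝ) ≤ L.card := by exact_mod_cast card_pos.2 ⟨o, ho⟩
    push_cast; linarith
  have hq0 : 0 ≤ ∑ i ∈ L.erase o, η i ^ 2 := sum_nonneg fun i _ => sq_nonneg _
  have hkpos : (0 : ℝ) < 2 * k + 1 := by positivity
  set m : ℝ := (k : ℝ) - L.card with hm
  set r : ℝ := (L.card : ℝ) - (1 : ℕ) with hr
  -- This gives 2m + r < 2k + 1, the strict gap that forces a = 0 at the end.
  have hk2 : (2 * k : ℝ) = 2 * m + 2 * r + 2 := by simp [hm, hr]; ring
  set q := ∑ i ∈ L.erase o, η i ^ 2 with hq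
  set b := ∑ i ∈ L.erase o, η i with hb
  set a := η o with ha
  have hw0 : 0 ≤ (a + b) ^ 2 / (2 * m) := by positivity
  have h1 : q + (a + b) ^ 2 / (2 * m) ≤ a ^ 2 / (2 * k + 1) := by
    have : (1 + 1 / (2 * (k : ℝ) + 1)) * a ^ 2 = a ^ 2 + a ^ 2 / (2 * k + 1) := by ring
    linarith
  -- Cauchy–Schwarz for a = (a + b) - b, with (a + b)² = 2m v and b² ≤ r q.
  have h2 : a ^ 2 ≤ (2 * m + r) * (q + (a + b) ^ 2 / (2 * m)) := by
    set v := (a + b) ^ 2 / (2 * m) with hv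
    have hv' : (a + b) ^ 2 = 2 * m * v := by rw [hv]; field_simp
    have hcross : 0 ≤ r * v + 2 * m * q + 2 * (a + b) * b := by
      rcases hr0.eq_or_lt with h0 | hpos
      · rw [← h0] at hcs ⊢
        have : b = 0 := by nlinarith
        rw [this]
        nlinarith
      · refine nonneg_of_mul_nonneg_right (a := 2 * m * r) ?_ (by positivity)
        have : 2 * m * r * (r * v + 2 * m * q + 2 * (a + b) * b) =
            (r * (a + b) + 2 * m * b) ^ 2 + (2 * m) ^ 2 * (r * q - b ^ 2) +
              r ^ 2 * (2 * m * v - (a + b) ^ 2) := by ring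
        rw [this, ← hv']
        have : 0 ≤ r * q - b ^ 2 := by linarith
        nlinarith [mul_nonneg (sq_nonneg (2 * m)) this, sq_nonneg (r * (a + b) + 2 * m * b)]
    have : a ^ 2 = (a + b) ^ 2 - 2 * (a + b) * b + b ^ 2 := by ring
    rw [this, hv']
    nlinarith
  have h3 : a ^ 2 ≤ (2 * m + r) * (a ^ 2 / (2 * k + 1)) :=
    h2.trans (mul_le_mul_of_nonneg_left h1 (by linarith))
  have h4 : a ^ 2 = 0 := by
    have : (2 * m + r) * (a ^ 2 / (2 * k + 1)) = ((2 * m + r) * a ^ 2) / (2 * k + 1) := by ring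
    rw [this, le_div_iff₀ hkpos] at h3
    nlinarith [sq_nonneg a]
  rw [h4, zero_div] at h1
  have h5 : q = 0 := by linarith
  intro i hi
  rcases eq_or_ne i o with rfl | hne
  · exact pow_eq_zero_iff two_ne_zero |>.1 h4
  · exact pow_eq_zero_iff two_ne_zero |>.1
      ((sum_eq_zero_iff_of_nonneg fun i _ => sq_nonneg (η i)).1 h5 i (mem_erase.2 ⟨hne, hi⟩))

end Limit

/-! ### Passing to the limit in logarithmic derivatives. -/

section Continuity

variable {n : ℕ}

theorem continuous_esymmOn_univ (k : ℕ) : Continuous fun x : Fin n → ℝ => esymmOn univ k x := by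
  unfold esymmOn
  fun_prop

theorem continuous_esymmD (k : ℕ) :
    Continuous fun p : (Fin n → ℝ) × (Fin n → ℝ) => esymmD univ k p.1 p.2 := by
  simp only [esymmD_eq_sum, dsigma]
  refine continuous_finsetSum _ fun i _ => ?_
  exact ((MvPolynomial.continuous_eval _).comp continuous_fst).mul (by fun_prop)

theorem continuous_esymmDD (k : ℕ) :
    Continuous fun p : (Fin n → ℝ) × (Fin n → ℝ) => esymmDD univ k p.1 p.2 := by
  simp only [esymmDD_eq_sum, ddsigma]
  refine continuous_finsetSum _ fun i _ => continuous_finsetSum _ fun j _ => ?_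
  exact (((MvPolynomial.continuous_eval _).comp continuous_fst).mul (by fun_prop)).mul
    (by fun_prop)

open Filter Topology

theorem tendsto_logGrad {α : Type*} {F : Filter α} {k : ℕ} {x y : α → Fin n → ℝ}
    {x₀ y₀ : Fin n → ℝ} (hx : Tendsto x F (𝓝 x₀)) (hy : Tendsto y F (𝓝 y₀))
    (h0 : esymmOn univ k x₀ ≠ 0) :
    Tendsto (fun a => logGrad univ k (x a) (y a)) F (𝓝 (logGrad univ k x₀ y₀)) :=
  (((continuous_esymmD k).tendsto (x₀, y₀)).comp (hx.prodMk_nhds hy)).div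
    (((continuous_esymmOn_univ k).tendsto x₀).comp hx) h0

theorem tendsto_logHess {α : Type*} {F : Filter α} {k : ℕ} {x y : α → Fin n → ℝ}
    {x₀ y₀ : Fin n → ℝ} (hx : Tendsto x F (𝓝 x₀)) (hy : Tendsto y F (𝓝 y₀))
    (h0 : esymmOn univ k x₀ ≠ 0) :
    Tendsto (fun a => logHess univ k (x a) (y a)) F (𝓝 (logHess univ k x₀ y₀)) :=
  ((((continuous_esymmDD k).tendsto (x₀, y₀)).comp (hx.prodMk_nhds hy)).div
    (((continuous_esymmOn_univ k).tendsto x₀).comp hx) h0).sub ((tendsto_logGrad hx hy h0).pow 2)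

theorem esymmOn_pos_of_forall_lt {k : ℕ} (hkn : k ≤ n) {x : Fin n → ℝ} (hx : ∀ i, 0 ≤ x i)
    (hpos : ∀ i : Fin n, i.val < k → 0 < x i) : 0 < esymmOn univ k x := by
  refine sum_pos' (fun t _ => prod_nonneg fun i _ => hx i)
    ⟨univ.map (Fin.castLEEmb hkn), mem_powersetCard.2 ⟨subset_univ _, by simp⟩, ?_⟩
  refine prod_pos fun i hi => hpos i ?_
  obtain ⟨j, -, rfl⟩ := mem_map.1 hi
  exact j.isLt

end Continuity

/-! ### The blow-up limit. -/

section Compactness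

open Filter Topology

variable {n : ℕ}

/-- Rescaled counterexamples to the concavity inequality cannot degenerate: a limit point would
violate the strict inequality for the limiting quadratic form. -/
theorem false_of_degenerating_sequence (hn : 0 < n) {k : ℕ} (hkn : k ≤ n) {A s₁ : ℝ}
    (hA : 0 ≤ A) {c : ℕ → ℝ} (hc : ∀ l, 0 < c l) (x y : ℕ → Fin n → ℝ)
    (hanti : ∀ N, Antitone (x N)) (hx1 : ∀ N, x N ⟨0, hn⟩ = 1)
    (hlow : ∀ N i, -A / (N + 1) ≤ x N i) (hy : ∀ N, ‖y N‖ = 1)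
    (hσ : ∀ N : ℕ, esymmOn univ k (x N) ≤ s₁ / (N + 1))
    (h : ∀ (N l : ℕ) (_ : 1 ≤ l) (hlk : l < k), 0 < x N ⟨l, hlk.trans_le hkn⟩ ∧
      -logHess univ l (x N) (y N) + logGrad univ l (x N) (y N) ^ 2 / (2 * ((k : ℝ) - l)) +
          c l / x N ⟨l, hlk.trans_le hkn⟩ *
            ∑ i ∈ Ici (⟨l, hlk.trans_le hkn⟩ : Fin n), y N i ^ 2 ≤
        (1 + 1 / (2 * (k : ℝ) + 1)) * y N ⟨0, hn⟩ ^ 2) : False := by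
  have hmem : ∀ N, (x N, y N) ∈ (Set.Icc (fun _ => -A) (fun _ => 1)) ×ˢ
      Metric.sphere (0 : Fin n → ℝ) 1 := by
    intro N
    refine ⟨⟨fun i => ?_, fun i => ?_⟩, by simpa using hy N⟩
    · refine le_trans ?_ (hlow N i)
      rw [neg_div, neg_le_neg_iff]
      exact div_le_self hA (by simp)
    · rw [← hx1 N]
      exact hanti N (Fin.mk_le_of_le_val (Nat.zero_le _))
  obtain ⟨⟨x₀, y₀⟩, ⟨-, hy₀⟩, φ, hφ, hlim⟩ :=
    (isCompact_Icc.prod (isCompact_sphere (0 : Fin n → ℝ) 1)).tendsto_subseq hmem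
  have hxl : Tendsto (fun N => x (φ N)) atTop (𝓝 x₀) := (continuous_fst.tendsto _).comp hlim
  have hyl : Tendsto (fun N => y (φ N)) atTop (𝓝 y₀) := (continuous_snd.tendsto _).comp hlim
  have hxi : ∀ i, Tendsto (fun N => x (φ N) i) atTop (𝓝 (x₀ i)) := tendsto_pi_nhds.1 hxl
  have hyi : ∀ i, Tendsto (fun N => y (φ N) i) atTop (𝓝 (y₀ i)) := tendsto_pi_nhds.1 hyl
  have hdiv : ∀ b : ℝ, Tendsto (fun N => b / ((φ N : ℝ) + 1)) atTop (𝓝 0) := fun b =>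
    (tendsto_const_nhds.div_atTop
      (tendsto_atTop_add_const_right _ _ tendsto_natCast_atTop_atTop)).comp hφ.tendsto_atTop
  have hx₀anti : Antitone x₀ := fun i j hij =>
    le_of_tendsto_of_tendsto' (hxi j) (hxi i) fun N => hanti _ hij
  have hx₀1 : x₀ ⟨0, hn⟩ = 1 :=
    tendsto_nhds_unique (hxi _) (by simp only [hx1]; exact tendsto_const_nhds)
  have hx₀nn : ∀ i, 0 ≤ x₀ i := fun i =>
    le_of_tendsto_of_tendsto' (hdiv (-A)) (hxi i) fun N => hlow _ i
  have hσ₀ : esymmOn univ k x₀ ≤ 0 :=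
    le_of_tendsto_of_tendsto' (((continuous_esymmOn_univ k).tendsto x₀).comp hxl) (hdiv s₁)
      fun N => hσ _
  -- Since σ_k(x₀) ≤ 0, the first k entries cannot all be positive. The least index l of a zero
  -- entry counts the positive ones, as indices start at 0.
  have hex : ∃ l : ℕ, ∃ hl : l < k, x₀ ⟨l, hl.trans_le hkn⟩ ≤ 0 := by
    by_contra! hcon
    exact hσ₀.not_gt (esymmOn_pos_of_forall_lt hkn hx₀nn fun i hi => hcon i.val hi)
  classical
  obtain ⟨l, ⟨hlk, hle⟩, hmin⟩ : ∃ l : ℕ, (∃ hl : l < k, x₀ ⟨l, hl.trans_le hkn⟩ ≤ 0) ∧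
      ∀ m < l, ¬ ∃ hm : m < k, x₀ ⟨m, hm.trans_le hkn⟩ ≤ 0 :=
    ⟨Nat.find hex, Nat.find_spec hex, fun m hm => Nat.find_min hex hm⟩
  have hl1 : 1 ≤ l := by
    by_contra! hl0
    obtain rfl : l = 0 := by omega
    rw [hx₀1] at hle
    linarith
  set p : Fin n := ⟨l, hlk.trans_le hkn⟩ with hp
  have hpos : ∀ i < p, 0 < x₀ i := by
    intro i hi
    by_contra! hneg
    exact hmin i.val hi ⟨lt_trans hi hlk, hneg⟩
  have hzero : ∀ i, p ≤ i → x₀ i = 0 := fun i hi =>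
    le_antisymm ((hx₀anti hi).trans hle) (hx₀nn i)
  have hoL : (⟨0, hn⟩ : Fin n) ∈ Iio p := mem_Iio.2 (Fin.mk_lt_of_lt_val hl1)
  have hcard : (Iio p).card = l := by simp [hp]
  have hne : ∀ i ∈ Iio p, x₀ i ≠ 0 := fun i hi => (hpos i (mem_Iio.1 hi)).ne'
  have hx₀L : ∀ i ∈ univ, i ∉ Iio p → x₀ i = 0 := fun i _ hi =>
    hzero i (not_lt.1 fun h => hi (mem_Iio.2 h))
  have hσl : esymmOn univ l x₀ ≠ 0 := by
    have := esymmOn_card_of_eq_zero (subset_univ (Iio p)) hx₀L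
    rw [hcard] at this
    rw [this]
    exact prod_ne_zero_iff.2 hne
  have hG := tendsto_logGrad hxl hyl hσl
  have hH := tendsto_logHess hxl hyl hσl
  have hΦ := hH.neg.add ((hG.pow 2).div_const (2 * ((k : ℝ) - l)))
  have hR : Tendsto (fun N => (1 + 1 / (2 * (k : ℝ) + 1)) * y (φ N) ⟨0, hn⟩ ^ 2) atTop
      (𝓝 ((1 + 1 / (2 * (k : ℝ) + 1)) * y₀ ⟨0, hn⟩ ^ 2)) := ((hyi _).pow 2).const_mul _
  have hS : Tendsto (fun N => ∑ i ∈ Ici p, y (φ N) i ^ 2) atTop (𝓝 (∑ i ∈ Ici p, y₀ i ^ 2)) :=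
    tendsto_finsetSum _ fun i _ => (hyi i).pow 2
  -- Multiplying by x_l → 0 removes every term except the one whose weight was c_l/x_l.
  have hS0 : c l * ∑ i ∈ Ici p, y₀ i ^ 2 ≤ 0 := by
    have hlt := ((hxi p).mul hΦ).add (hS.const_mul (c l))
    have hrt := (hxi p).mul hR
    have := le_of_tendsto_of_tendsto' hlt hrt fun N => by
      obtain ⟨hxp, hin⟩ := h (φ N) l hl1 hlk
      have := mul_le_mul_of_nonneg_left hin hxp.le
      refine le_trans (le_of_eq ?_) this
      have hxp' : x (φ N) p ≠ 0 := hxp.ne'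
      rw [← hp, mul_add _ (_ + _), ← mul_assoc (x (φ N) p) (c l / _), mul_div_cancel₀ _ hxp']
    rw [hzero p le_rfl, zero_mul, zero_mul, zero_add] at this
    exact this
  have hsum0 : ∑ i ∈ Ici p, y₀ i ^ 2 = 0 :=
    le_antisymm (nonpos_of_mul_nonpos_right hS0 (hc l)) (sum_nonneg fun i _ => sq_nonneg _)
  have hy₀L : ∀ i ∈ univ, i ∉ Iio p → y₀ i = 0 := fun i _ hi =>
    pow_eq_zero_iff two_ne_zero |>.1 ((sum_eq_zero_iff_of_nonneg fun i _ => sq_nonneg (y₀ i)).1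
      hsum0 i (mem_Ici.2 (not_lt.1 fun h => hi (mem_Iio.2 h))))
  -- The weighted sum is now dropped before the limit, since only its sign is needed.
  have hfin := le_of_tendsto_of_tendsto' hΦ hR fun N => by
    obtain ⟨hxp, hin⟩ := h (φ N) l hl1 hlk
    refine le_trans ?_ hin
    have : 0 ≤ c l / x (φ N) p * ∑ i ∈ Ici p, y (φ N) i ^ 2 :=
      mul_nonneg (div_nonneg (hc l).le hxp.le) (sum_nonneg fun i _ => sq_nonneg _)
    linarith
  have e1 := logHess_of_eq_zero (subset_univ (Iio p)) hne hx₀L hy₀L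
  have e2 := logGrad_of_eq_zero (subset_univ (Iio p)) hne hx₀L hy₀L
  rw [hcard] at e1 e2
  rw [e1, e2, neg_neg] at hfin
  have hη := eq_zero_of_sum_sq_le (η := fun i => y₀ i / x₀ i) hoL (hcard.trans_lt hlk)
    (by rw [hcard]; simpa [hx₀1] using hfin)
  have hy0 : y₀ = 0 := by
    ext i
    by_cases hi : i ∈ Iio p
    · exact (div_eq_zero_iff.1 (hη i hi)).resolve_right (hne i hi)
    · exact hy₀L i (mem_univ i) hi
  rw [hy0] at hy₀
  simp at hy₀

end Compactness

/-! ### Reduction of the inequality to the compactness statement. -/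

section Main

variable {n : ℕ}

/-- Since r y = c · (r/c) y, homogeneity cancels c^k. This lets λ and ξ be normalised independently.
-/
theorem logGrad_scale (k : ℕ) {c : ℝ} (hc : c ≠ 0) (r : ℝ) (x y : Fin n → ℝ) :
    logGrad univ k (fun i => c * x i) (fun i => r * y i) = r / c * logGrad univ k x y := by
  have h1 : (fun i => r * y i) = fun i => c * ((r / c) * y i) := by
    ext i; field_simp
  have h2 : esymmD univ k x (fun i => r / c * y i) = r / c * esymmD univ k x y := by
    simp only [esymmD_eq_sum, mul_sum]
    exact sum_congr rfl fun i _ => by ring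
  rw [logGrad, h1, esymmD_smul, esymmOn_smul, h2, mul_div_mul_left _ _ (pow_ne_zero k hc),
    mul_div_assoc, logGrad]

theorem logHess_scale (k : ℕ) {c : ℝ} (hc : c ≠ 0) (r : ℝ) (x y : Fin n → ℝ) :
    logHess univ k (fun i => c * x i) (fun i => r * y i) = (r / c) ^ 2 * logHess univ k x y := by
  have h1 : (fun i => r * y i) = fun i => c * ((r / c) * y i) := by
    ext i; field_simp
  have h2 : esymmDD univ k x (fun i => r / c * y i) = (r / c) ^ 2 * esymmDD univ k x y := by
    simp only [esymmDD_eq_sum, mul_sum]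
    exact sum_congr rfl fun i _ => sum_congr rfl fun j _ => by ring
  have h3 := logGrad_scale k hc r x y
  rw [logGrad, logGrad] at h3
  rw [logHess, h3, h1, esymmDD_smul, esymmOn_smul, h2, mul_div_mul_left _ _ (pow_ne_zero k hc),
    mul_div_assoc, logHess]
  ring

theorem gardingOn_of_mem {k : ℕ} {lam : Fin n → ℝ} (h : lam ∈ gardingCone n k) :
    GardingOn univ k lam := by
  intro j hj
  rcases Nat.eq_zero_or_pos j with rfl | hj0
  · simp
  · rw [← sigma_eq_esymmOn]
    exact h j hj0 hj

/-- `σ_k ≤ c⁻¹ λ_l ∂σ_k/∂λ_i` for all `i ≥ l`, where `l < k`. -/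
theorem sigma_le_mul_dsigma {k l : ℕ} (hkn : k ≤ n) (hlk : l < k) {lam : Fin n → ℝ}
    (hlam : lam ∈ gardingCone n k) (hanti : Antitone lam) {i : Fin n}
    (hi : ⟨l, hlk.trans_le hkn⟩ ≤ i) :
    0 < lam ⟨l, hlk.trans_le hkn⟩ ∧
      sigma k lam ≤ (2 * n) ^ (l + 1) * (lam ⟨l, hlk.trans_le hkn⟩ * dsigma k lam i) := by
  obtain ⟨k, rfl⟩ : ∃ k', k = k' + 1 := ⟨k - 1, by omega⟩
  have hG := gardingOn_of_mem hlam
  set p : Fin n := ⟨l, hlk.trans_le hkn⟩ with hp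
  have hcard : (Iio p).card = l := by simp [hp]
  have h1 := hG.esymmOn_le_of_card_lt (mem_univ p) (subset_univ (Iio p)) (by simp)
    (by rw [hcard]; omega) (fun i hi => hanti (mem_Iio.1 hi).le)
    (fun i _ hi => hanti (not_lt.1 fun h => hi (mem_Iio.2 h))) (N := n) (by simp)
  rw [hcard] at h1
  have h2 := hG.esymmOn_erase_le (mem_univ p) (mem_univ i) (hanti hi)
  have hpos := hG (k + 1) le_rfl
  have hd := hG.erase (mem_univ p) k le_rfl
  have hQ : (0 : ℝ) ≤ (2 * n) ^ (l + 1) := by positivity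
  have hlp : 0 < lam p := by
    by_contra! hneg
    nlinarith [mul_nonneg hQ (mul_nonneg (neg_nonneg.2 hneg) hd.le)]
  refine ⟨hlp, ?_⟩
  rw [sigma_eq_esymmOn, dsigma_eq_esymmOn]
  refine h1.trans ?_
  gcongr

theorem dsigma_pos {k : ℕ} (hk : 1 ≤ k) {lam : Fin n → ℝ} (hlam : lam ∈ gardingCone n k)
    (i : Fin n) : 0 < dsigma k lam i := by
  obtain ⟨k, rfl⟩ : ∃ k', k = k' + 1 := ⟨k - 1, by omega⟩
  rw [dsigma_eq_esymmOn]
  exact (gardingOn_of_mem hlam).erase (mem_univ i) k le_rfl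

/-- The left-hand side of the concavity inequality. -/
noncomputable def concavityForm (hn : 0 < n) (k : ℕ) (A K : ℝ) (lam ξ : Fin n → ℝ) : ℝ :=
  -(∑ p, ∑ q, ddsigma k lam p q * ξ p * ξ q / sigma k lam)
    + K * ((∑ i, dsigma k lam i * ξ i) ^ 2 / sigma k lam ^ 2)
    + 2 * ∑ i ∈ Finset.Ioi (⟨0, hn⟩ : Fin n),
        dsigma k lam i * ξ i ^ 2 / ((lam ⟨0, hn⟩ + A + 1) * sigma k lam)

/-- The lower bound does not involve K, so K may vary along the blow-up sequence. -/
theorem le_concavityForm (hn : 0 < n) {k l : ℕ} (hkn : k ≤ n) (hl : 1 ≤ l) (hlk : l < k)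
    {A K : ℝ} (hA : 0 ≤ A) (hK : 2 ≤ K) {lam : Fin n → ℝ} (hlam : lam ∈ gardingCone n k)
    (hanti : Antitone lam) (hlarge : A + 1 ≤ lam ⟨0, hn⟩) (ξ : Fin n → ℝ) :
    -logHess univ l lam ξ + logGrad univ l lam ξ ^ 2 / (2 * ((k : ℝ) - l)) +
        ((2 * (n : ℝ)) ^ (l + 1))⁻¹ / (lam ⟨0, hn⟩ * lam ⟨l, hlk.trans_le hkn⟩) *
          ∑ i ∈ Ici (⟨l, hlk.trans_le hkn⟩ : Fin n), ξ i ^ 2 ≤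
      concavityForm hn k A K lam ξ := by
  have hG := gardingOn_of_mem hlam
  have hσ : 0 < sigma k lam := hlam k (by omega) le_rfl
  set p : Fin n := ⟨l, hlk.trans_le hkn⟩ with hp
  have hlp : 0 < lam p := (sigma_le_mul_dsigma hkn hlk hlam hanti le_rfl).1
  have hnR : (0 : ℝ) < n := by exact_mod_cast hn
  set o : Fin n := ⟨0, hn⟩ with ho
  have hlo : 0 < lam o := by linarith
  have hfirst : -logHess univ l lam ξ + logGrad univ l lam ξ ^ 2 / (2 * ((k : ℝ) - l)) ≤
      -(∑ p, ∑ q, ddsigma k lam p q * ξ p * ξ q / sigma k lam)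
        + K * ((∑ i, dsigma k lam i * ξ i) ^ 2 / sigma k lam ^ 2) := by
    obtain ⟨m, rfl⟩ : ∃ m, k = l + m := ⟨k - l, by omega⟩
    have h := hG.logHess_add_le ξ
    have hm : (1 : ℝ) ≤ m := by
      have : 1 ≤ m := by omega
      exact_mod_cast this
    have e1 : ∑ p, ∑ q, ddsigma (l + m) lam p q * ξ p * ξ q / sigma (l + m) lam =
        logHess univ (l + m) lam ξ + logGrad univ (l + m) lam ξ ^ 2 := by
      simp only [← sum_div]
      rw [← esymmDD_eq_sum, sigma_eq_esymmOn, logHess, logGrad]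
      ring
    have e2 : (∑ i, dsigma (l + m) lam i * ξ i) ^ 2 / sigma (l + m) lam ^ 2 =
        logGrad univ (l + m) lam ξ ^ 2 := by
      rw [← esymmD_eq_sum, sigma_eq_esymmOn, logGrad, div_pow]
    rw [e1, e2]
    push_cast
    rw [add_sub_cancel_left]
    generalize logHess univ (l + m) lam ξ = H at *
    generalize logHess univ l lam ξ = H' at *
    generalize logGrad univ (l + m) lam ξ = g at *
    generalize logGrad univ l lam ξ = g' at *
    -- Concavity gives H' - H ≥ (g - g')²/m. Since m ≥ 1 and 2(g - g')² + 2g² ≥ g'², one extra copy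
    -- of g² suffices. With the copy contained in H + g² this makes K ≥ 2.
    have h1 : g' ^ 2 / (2 * (m : ℝ)) ≤ H' - H + g ^ 2 := by
      rw [div_le_iff₀ (by positivity)]
      nlinarith [sq_nonneg (2 * g - g'), mul_nonneg (sub_nonneg.2 hm) (sq_nonneg g)]
    nlinarith [mul_nonneg (sub_nonneg.2 hK) (sq_nonneg g)]
  have hpos : ∀ i, 0 ≤ dsigma k lam i * ξ i ^ 2 / ((lam o + A + 1) * sigma k lam) := fun i =>
    div_nonneg (mul_nonneg (dsigma_pos (by omega) hlam i).le (sq_nonneg _)) (by positivity)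
  have hsub : Ici p ⊆ Ioi o := fun i hi =>
    mem_Ioi.2 (lt_of_lt_of_le (Fin.mk_lt_of_lt_val hl) (mem_Ici.1 hi))
  have hsecond : ((2 * (n : ℝ)) ^ (l + 1))⁻¹ / (lam o * lam p) * ∑ i ∈ Ici p, ξ i ^ 2 ≤
      2 * ∑ i ∈ Ioi o, dsigma k lam i * ξ i ^ 2 / ((lam o + A + 1) * sigma k lam) := by
    refine le_trans ?_ (mul_le_mul_of_nonneg_left
      (sum_le_sum_of_subset_of_nonneg hsub fun i _ _ => hpos i) zero_le_two)
    rw [mul_sum, mul_sum]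
    refine sum_le_sum fun i hi => ?_
    have h1 := (sigma_le_mul_dsigma hkn hlk hlam hanti (mem_Ici.1 hi)).2
    have hd := dsigma_pos (by omega) hlam i
    have hQ : (0 : ℝ) < (2 * n) ^ (l + 1) := by positivity
    have h2 : ((2 * (n : ℝ)) ^ (l + 1))⁻¹ / (lam o * lam p) ≤
        2 * (dsigma k lam i / ((lam o + A + 1) * sigma k lam)) := by
      calc ((2 * (n : ℝ)) ^ (l + 1))⁻¹ / (lam o * lam p)
          ≤ dsigma k lam i / (lam o * sigma k lam) := by
            rw [inv_eq_one_div, div_div, div_le_div_iff₀ (by positivity) (by positivity)]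
            calc 1 * (lam o * sigma k lam)
                ≤ 1 * (lam o * ((2 * n) ^ (l + 1) * (lam p * dsigma k lam i))) := by gcongr
              _ = _ := by ring
        -- The factor 2 in front of the sum pays for λ_1 + A + 1 ≤ 2λ_1.
        _ = 2 * (dsigma k lam i / ((2 * lam o) * sigma k lam)) := by field_simp
        _ ≤ 2 * (dsigma k lam i / ((lam o + A + 1) * sigma k lam)) := by
            gcongr
            linarith
    calc _ ≤ 2 * (dsigma k lam i / ((lam o + A + 1) * sigma k lam)) * ξ i ^ 2 :=
          mul_le_mul_of_nonneg_right h2 (sq_nonneg _)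
      _ = _ := by ring
  rw [concavityForm]
  exact add_le_add hfirst hsecond

theorem exists_concavityForm_bound {k : ℕ} (hn : 0 < n) (hkn : k ≤ n) {A : ℝ} (hA : 0 < A)
    (s₁ : ℝ) (hk : 1 ≤ k) :
    ∃ C : ℝ, 0 < C ∧
      ∀ lam : Fin n → ℝ, lam ∈ gardingCone n k → Antitone lam →
        -A < lam ⟨n - 1, Nat.sub_lt hn Nat.one_pos⟩ → sigma k lam ≤ s₁ → C ≤ lam ⟨0, hn⟩ →
        ∀ K : ℝ, 2 ≤ K → ∀ ξ : Fin n → ℝ,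
          (1 + 1 / (2 * (k : ℝ) + 1)) * (ξ ⟨0, hn⟩ ^ 2 / lam ⟨0, hn⟩ ^ 2) ≤
            concavityForm hn k A K lam ξ := by
  by_contra! hcon
  -- The threshold A + 1 + N gives both A + 1 ≤ λ_1, needed for the lower bound, and λ_1 ≥ N + 1,
  -- needed for the blow-up.
  choose lam hlam hanti hlow hσ hlarge K hK ξ hfail using
    fun N : ℕ => hcon (A + 1 + N) (by positivity)
  have hlo : ∀ N, 0 < lam N ⟨0, hn⟩ := fun N =>
    lt_of_lt_of_le (by positivity) (hlarge N)
  have hξ : ∀ N, 0 < ‖ξ N‖ := by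
    intro N
    rw [norm_pos_iff]
    intro h0
    have := hfail N
    simp [concavityForm, h0] at this
  have hxe : ∀ N, lam N = fun i => lam N ⟨0, hn⟩ * (lam N i / lam N ⟨0, hn⟩) := fun N => by
    ext i; rw [mul_div_cancel₀ _ (hlo N).ne']
  have hye : ∀ N, ξ N = fun i => ‖ξ N‖ * (ξ N i / ‖ξ N‖) := fun N => by
    ext i; rw [mul_div_cancel₀ _ (hξ N).ne']
  have hnR : (0 : ℝ) < n := by exact_mod_cast hn
  have hN : ∀ N : ℕ, (N : ℝ) + 1 ≤ lam N ⟨0, hn⟩ := fun N => by linarith [hlarge N]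
  refine false_of_degenerating_sequence hn hkn (s₁ := s₁) hA.le
    (c := fun l => ((2 * (n : ℝ)) ^ (l + 1))⁻¹) (fun l => by positivity)
    (fun N i => lam N i / lam N ⟨0, hn⟩) (fun N i => ξ N i / ‖ξ N‖)
    (fun N i j hij => div_le_div_of_nonneg_right (hanti N hij) (hlo N).le)
    (fun N => div_self (hlo N).ne') (fun N i => ?_) (fun N => ?_) (fun N => ?_)
    (fun N l hl hlk => ?_)
  · have h1 : -A ≤ lam N i :=
      (hlow N).le.trans (hanti N (Fin.mk_le_mk.2 (Nat.le_sub_one_of_lt i.isLt)))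
    rw [div_le_div_iff₀ (by positivity) (hlo N)]
    nlinarith [hN N, mul_le_mul_of_nonneg_left (hN N) hA.le,
      mul_le_mul_of_nonneg_right h1 (by positivity : (0 : ℝ) ≤ N + 1)]
  · have : (fun i => ξ N i / ‖ξ N‖) = ‖ξ N‖⁻¹ • ξ N := by
      ext i; simp [div_eq_inv_mul]
    rw [this, norm_smul, norm_inv, norm_norm, inv_mul_cancel₀ (hξ N).ne']
  · have h1 := hσ N
    have hpos : 0 < sigma k (lam N) := hlam N k hk le_rfl
    rw [sigma_eq_esymmOn, hxe N, esymmOn_smul] at h1 hpos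
    rw [le_div_iff₀ (by positivity)]
    refine le_trans ?_ h1
    rw [mul_comm]
    refine mul_le_mul_of_nonneg_right ?_
      (pos_of_mul_pos_right hpos (pow_nonneg (hlo N).le k)).le
    -- Here k ≥ 1 enters: N + 1 ≤ λ_1 ≤ λ_1^k, so the rescaled σ_k is at most s₁/(N + 1).
    exact (hN N).trans (le_self_pow₀ (by
      have : (0 : ℝ) ≤ N := Nat.cast_nonneg N
      linarith [hN N]) (by omega))
  · have hlp := (sigma_le_mul_dsigma hkn hlk (hlam N) (hanti N) le_rfl).1
    refine ⟨div_pos hlp (hlo N), ?_⟩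
    have hle := (le_concavityForm hn hkn hl hlk hA.le (hK N) (hlam N) (hanti N)
      (by linarith [hlarge N, (Nat.cast_nonneg N : (0 : ℝ) ≤ N)]) (ξ N)).trans (hfail N).le
    have e1 := logHess_scale l (hlo N).ne' ‖ξ N‖ (fun i => lam N i / lam N ⟨0, hn⟩)
      (fun i => ξ N i / ‖ξ N‖)
    have e2 := logGrad_scale l (hlo N).ne' ‖ξ N‖ (fun i => lam N i / lam N ⟨0, hn⟩)
      (fun i => ξ N i / ‖ξ N‖)
    rw [← hxe N, ← hye N] at e1 e2
    rw [e1, e2] at hle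
    have hr : 0 < (‖ξ N‖ / lam N ⟨0, hn⟩) ^ 2 := pow_pos (div_pos (hξ N) (hlo N)) 2
    refine le_of_mul_le_mul_left ?_ hr
    have hb := (hlo N).ne'
    have hb' := (hξ N).ne'
    have hb'' := hlp.ne'
    refine le_trans (le_of_eq ?_) (hle.trans (le_of_eq ?_))
    · rw [mul_add, mul_add]
      congr 1
      · ring
      · simp only [div_pow, ← sum_div]
        field_simp
    · field_simp

end Main

theorem lemma3p1 (k : ℕ) (hk : 1 ≤ k) :
    ∃ δ₀ : ℝ, 0 < δ₀ ∧ ∃ K₀ : ℝ, 0 < K₀ ∧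
      ∀ (n : ℕ) (hn : 0 < n), k ≤ n →
      ∀ A : ℝ, 0 < A → ∀ s₀ s₁ : ℝ, 0 < s₀ → s₀ ≤ s₁ →
      ∃ C : ℝ, 0 < C ∧
        ∀ lam : Fin n → ℝ, lam ∈ gardingCone n k → Antitone lam →
          -A < lam ⟨n - 1, Nat.sub_lt hn Nat.one_pos⟩ →
          s₀ ≤ sigma k lam → sigma k lam ≤ s₁ →
          C ≤ lam ⟨0, hn⟩ →
          ∀ K : ℝ, K₀ ≤ K → ∀ ξ : Fin n → ℝ,
            (1 + δ₀) * (ξ ⟨0, hn⟩ ^ 2 / lam ⟨0, hn⟩ ^ 2) ≤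
              -(∑ p, ∑ q, ddsigma k lam p q * ξ p * ξ q / sigma k lam)
                + K * ((∑ i, dsigma k lam i * ξ i) ^ 2 / sigma k lam ^ 2)
                + 2 * ∑ i ∈ Finset.Ioi (⟨0, hn⟩ : Fin n),
                    dsigma k lam i * ξ i ^ 2 / ((lam ⟨0, hn⟩ + A + 1) * sigma k lam) := by
  -- δ₀ is below the gain 1/(2(k - l) + l - 1) of the limiting form for every 1 ≤ l < k.
  refine ⟨1 / (2 * (k : ℝ) + 1), by positivity, 2, two_pos, ?_⟩
  intro n hn hkn A hA s₀ s₁ _ _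
  obtain ⟨C, hC, h⟩ := exists_concavityForm_bound hn hkn hA s₁ hk
  exact ⟨C, hC, fun lam hlam hanti hlow _ hs₁ hlarge K hK ξ =>
    h lam hlam hanti hlow hs₁ hlarge K hK ξ⟩
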